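/- Let $\kappa\in\mathbb{R}$. Let $M_\kappa^2$ be the complete, simply connected, two-dimensional Riemannian manifold of constant Gaussian curvature $\kappa$, with distance function $d_\kappa$, and let $D_\kappa=\pi/\sqrt{\kappa}$ if $\kappa>0$ and $D_\kappa=\infty$ if $\kappa\le 0$ be its diameter. For $a,b\in M_\kappa^2$ with $d_\kappa(a,b)<D_\kappa$, let $[a,b]$ be the unique geodesic segment with endpoints $a$ and $b$, that is, the image of an isometric embedding $\gamma:[0,d_\kappa(a,b)]\to M_\kappa^2$ with $\gamma(0)=a$ and $\gamma(d_\kappa(a,b))=b$. A metric space $(X,d_X)$ is a $\mathrm{Cycl}_4(\kappa)$ space if for every map $f:\mathbb{Z}/4\mathbb{Z}\to X$ with $\sum_{i\in\mathbb{Z}/4\mathbb{Z}}d_X(f(i),f(i+1))<2D_\kappa$ there exists a map $g:\mathbb{Z}/4\mathbb{Z}\to M_\kappa^2$ such that $d_\kappa(g(i),g(i+1))\le d_X(f(i),f(i+1))$ for all $i$, and $d_\kappa(g(i),g(j))\ge d_X(f(i),f(j))$ for all $i,j$ with $j\ne i+1$ and $i\ne j+1$. **Lemma.** Every $\mathrm{Cycl}_4(\kappa)$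 space $(X,d_X)$ satisfies the $\kappa$-quadruple condition: for all $x,y,z,w\in X$ and all $x',y',z',w'\in M_\kappa^2$ such that $$d_X(x,y)+d_X(y,z)+d_X(z,w)+d_X(w,x)<2D_\kappa,\qquad [x',z']\cap[y',w']\ne\emptyset,$$ $$d_X(x,y)=d_\kappa(x',y'),\quad d_X(y,z)=d_\kappa(y',z'),\quad d_X(z,w)=d_\kappa(z',w'),$$ $$d_X(w,x)=d_\kappa(w',x'),\quad d_X(x,z)=d_\kappa(x',z'),$$ we have $d_X(y,w)\le d_\kappa(y',w')$. -/

import Mathlib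

noncomputable section

/-- The model surface of constant curvature `κ`: the complete simply connected surface, as the
locus `t ^ 2 + κ * (a ^ 2 + b ^ 2) = 1` in `ℝ³`, restricted to the sheet `t > 0` if `κ ≤ 0`.
* If `κ > 0`, then `(t, a, b) ↦ (t / √κ, a, b)` identifies it with the round sphere of
  radius `1 / √κ`.
* If `κ = 0`, it is the plane `t = 1` with coordinates `a, b`.
* If `κ < 0`, then `(t, a, b) ↦ (t / √(-κ), a, b)` identifies it with the upper sheet
  `T ^ 2 - a ^ 2 - b ^ 2 = 1 / (-κ)`, `T > 0`, of the hyperboloid in Minkowski space. -/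
structure ModelSurface (κ : ℝ) where
  t : ℝ
  a : ℝ
  b : ℝ
  eqn : t ^ 2 + κ * (a ^ 2 + b ^ 2) = 1
  sheet : κ ≤ 0 → 0 < t

/-- The symmetric bilinear form whose unit vectors form the model surface. -/
def modelForm {κ : ℝ} (p q : ModelSurface κ) : ℝ :=
  p.t * q.t + κ * (p.a * q.a + p.b * q.b)

/-- The Riemannian distance `d_κ` on the model surface of curvature `κ`: the great-circle distance
on the sphere of radius `1 / √κ` if `κ > 0`, the Euclidean distance if `κ = 0`, and the hyperbolic
distance of the hyperboloid model, scaled to curvature `κ`, if `κ < 0`. -/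
def modelDist {κ : ℝ} (p q : ModelSurface κ) : ℝ :=
  if 0 < κ then Real.arccos (modelForm p q) / √κ
  else if κ = 0 then √((p.a - q.a) ^ 2 + (p.b - q.b) ^ 2)
  else Real.arcosh (modelForm p q) / √(-κ)

/-- The diameter `D_κ` of the model surface: `π / √κ` if `κ > 0`, and `∞` if `κ ≤ 0`. -/
def modelDiam (κ : ℝ) : EReal :=
  if 0 < κ then ((Real.pi / √κ : ℝ) : EReal) else ⊤

/-- `S` is a geodesic segment with endpoints `x` and `y` in the model surface: the image of an
isometric embedding `γ : [0, d_κ(x, y)] → M_κ²` with `γ 0 = x` and `γ (d_κ(x, y)) = y`. -/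
def IsGeodesicSegment {κ : ℝ} (x y : ModelSurface κ) (S : Set (ModelSurface κ)) : Prop :=
  ∃ γ : ℝ → ModelSurface κ,
    γ 0 = x ∧ γ (modelDist x y) = y ∧
    (∀ s ∈ Set.Icc 0 (modelDist x y), ∀ u ∈ Set.Icc 0 (modelDist x y),
      modelDist (γ s) (γ u) = |s - u|) ∧
    S = γ '' Set.Icc 0 (modelDist x y)

/-- The set of points lying on a geodesic segment with endpoints `x` and `y`. If
`d_κ(x, y) < D_κ`, that segment is unique, and this is the segment `[x, y]`. -/
def modelSegment {κ : ℝ} (x y : ModelSurface κ) : Set (ModelSurface κ) :=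
  {p | ∃ S, IsGeodesicSegment x y S ∧ p ∈ S}

/-- The `Cycl_n(κ)` condition on a metric space (used for `n ≥ 4`). -/
def IsCycl (n : ℕ) [NeZero n] (κ : ℝ) (X : Type*) [MetricSpace X] : Prop :=
  ∀ f : ZMod n → X,
    ((∑ i : ZMod n, dist (f i) (f (i + 1)) : ℝ) : EReal) < 2 * modelDiam κ →
    ∃ g : ZMod n → ModelSurface κ,
      (∀ i, modelDist (g i) (g (i + 1)) ≤ dist (f i) (f (i + 1))) ∧
      (∀ i j, j ≠ i + 1 → i ≠ j + 1 → dist (f i) (f j) ≤ modelDist (g i) (g j))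

/-- The `κ`-quadruple condition on a metric space. -/
def QuadrupleCondition (κ : ℝ) (X : Type*) [MetricSpace X] : Prop :=
  ∀ (x y z w : X) (x' y' z' w' : ModelSurface κ),
    ((dist x y + dist y z + dist z w + dist w x : ℝ) : EReal) < 2 * modelDiam κ →
    (modelSegment x' z' ∩ modelSegment y' w').Nonempty →
    dist x y = modelDist x' y' →
    dist y z = modelDist y' z' →
    dist z w = modelDist z' w' →
    dist w x = modelDist w' x' →
    dist x z = modelDist x' z' →
    dist y w ≤ modelDist y' w'

end

/-!
The proof compares two configurations of four points in the model surface. The condition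
`IsCycl 4 κ X` supplies points `x₂, y₂, z₂, w₂` whose sides are at most those of `x', y', z', w'`,
with `d(x', z') ≤ d(x₂, z₂)` and `dist y w ≤ d(y₂, w₂)`, so it is enough to show
`d(y₂, w₂) ≤ d(y', w')`.

Regard points as vectors of `ℝ³` with the form `⟪u, v⟫` of the model. A common point of the two
diagonals is a vector `α x' + β z' = γ y' + δ w'` with nonnegative coefficients
(`exists_nonneg_combination`). Put `P = α x₂ + β z₂` and `Q = γ y₂ + δ w₂`, and suppose first that
`γ, δ > 0`.
* If `κ > 0`, the distance decreases with the form, and expanding `0 ≤ ⟪P - Q, P - Q⟫` against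
  the same expansion for the primed points, whose value is `0`, bounds `⟪y₂, w₂⟫` from below.
* If `κ < 0`, the distance increases with the form. If `⟪y₂, w₂⟫ > ⟪y', w'⟫`, then
  `⟪P, P⟫ ≥ 1`, `⟪Q, Q⟫ > 1` and `0 < ⟪P, Q⟫ ≤ 1`, against the reversed Cauchy–Schwarz inequality
  for timelike vectors (`ambientForm_mul_le_sq`).
* If `κ = 0`, then `α + β = γ + δ = 1`, and the expansion of `0 ≤ |P - Q|²` in squared distances
  does the same.

If `γ = 0` or `δ = 0`, the common point is a vertex, say `y'`. The same inequalities are then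
equalities, so that `y₂ = α x₂ + β z₂`, and `d(y₂, w₂)` is determined by the distances from `w₂`
to `x₂` and `z₂` in the same way as `d(y', w')`.
-/

/-! ### The ambient form -/

/-- The symmetric bilinear form on `ℝ³` that restricts to `modelForm`: Euclidean up to scaling if
`κ > 0`, degenerate if `κ = 0`, and Lorentzian if `κ < 0`. -/
def ambientForm (κ : ℝ) (u v : ℝ × ℝ × ℝ) : ℝ :=
  u.1 * v.1 + κ * (u.2.1 * v.2.1 + u.2.2 * v.2.2)

/-- The position vector of a point of the model surface. -/
def ModelSurface.vec {κ : ℝ} (p : ModelSurface κ) : ℝ × ℝ × ℝ := (p.t, p.a, p.b)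

theorem ModelSurface.vec_injective {κ : ℝ} :
    Function.Injective (ModelSurface.vec : ModelSurface κ → ℝ × ℝ × ℝ) := by
  rintro ⟨t, a, b, _, _⟩ ⟨t', a', b', _, _⟩ h
  simp only [ModelSurface.vec, Prod.mk.injEq] at h
  obtain ⟨rfl, rfl, rfl⟩ := h
  rfl

theorem modelForm_eq_ambientForm {κ : ℝ} (p q : ModelSurface κ) :
    modelForm p q = ambientForm κ p.vec q.vec := rfl

theorem ambientForm_vec_self {κ : ℝ} (p : ModelSurface κ) : ambientForm κ p.vec p.vec = 1 := by
  have := p.eqn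
  simp only [ambientForm, ModelSurface.vec]
  linear_combination this

theorem ambientForm_comm (κ : ℝ) (u v : ℝ × ℝ × ℝ) : ambientForm κ u v = ambientForm κ v u := by
  simp only [ambientForm]; ring

theorem ambientForm_add_left (κ : ℝ) (u v w : ℝ × ℝ × ℝ) :
    ambientForm κ (u + v) w = ambientForm κ u w + ambientForm κ v w := by
  simp only [ambientForm, Prod.fst_add, Prod.snd_add]; ring

theorem ambientForm_add_right (κ : ℝ) (u v w : ℝ × ℝ × ℝ) :
    ambientForm κ u (v + w) = ambientForm κ u v + ambientForm κ u w := by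
  simp only [ambientForm, Prod.fst_add, Prod.snd_add]; ring

theorem ambientForm_sub_left (κ : ℝ) (u v w : ℝ × ℝ × ℝ) :
    ambientForm κ (u - v) w = ambientForm κ u w - ambientForm κ v w := by
  simp only [ambientForm, Prod.fst_sub, Prod.snd_sub]; ring

theorem ambientForm_sub_right (κ : ℝ) (u v w : ℝ × ℝ × ℝ) :
    ambientForm κ u (v - w) = ambientForm κ u v - ambientForm κ u w := by
  simp only [ambientForm, Prod.fst_sub, Prod.snd_sub]; ring

theorem ambientForm_smul_left (κ c : ℝ) (u v : ℝ × ℝ × ℝ) :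
    ambientForm κ (c • u) v = c * ambientForm κ u v := by
  simp only [ambientForm, Prod.smul_fst, Prod.smul_snd, smul_eq_mul]; ring

theorem ambientForm_smul_right (κ c : ℝ) (u v : ℝ × ℝ × ℝ) :
    ambientForm κ u (c • v) = c * ambientForm κ u v := by
  simp only [ambientForm, Prod.smul_fst, Prod.smul_snd, smul_eq_mul]; ring

theorem ambientForm_self_nonneg {κ : ℝ} (hκ : 0 < κ) (v : ℝ × ℝ × ℝ) :
    0 ≤ ambientForm κ v v := by
  simp only [ambientForm, ← sq]; positivity

theorem eq_zero_of_ambientForm_self_nonpos {κ : ℝ} (hκ : 0 < κ) {v : ℝ × ℝ × ℝ}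
    (h : ambientForm κ v v ≤ 0) : v = 0 := by
  obtain ⟨t, a, b⟩ := v
  simp only [ambientForm, ← sq] at h
  have ha : 0 ≤ κ * a ^ 2 := by positivity
  have hb : 0 ≤ κ * b ^ 2 := by positivity
  have ht := sq_nonneg t
  have h1 : t ^ 2 = 0 := by linarith
  have h2 : κ * a ^ 2 = 0 := by linarith
  have h3 : κ * b ^ 2 = 0 := by linarith
  simp_all [hκ.ne']

/-- For `κ < 0`, the orthogonal complement of a timelike vector is spacelike. -/
theorem eq_zero_of_ambientForm_eq_zero {κ : ℝ} (hκ : κ < 0) {u v : ℝ × ℝ × ℝ}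
    (hu : 0 < ambientForm κ u u) (huv : ambientForm κ u v = 0) (hv : 0 ≤ ambientForm κ v v) :
    v = 0 := by
  obtain ⟨t, a, b⟩ := u
  obtain ⟨s, c, d⟩ := v
  simp only [ambientForm] at hu huv hv
  have hs : (t * t + κ * (a * a + b * b)) * s ^ 2 ≤ 0 := by
    have e : t * s = -κ * (a * c + b * d) := by linarith
    have e2 : (t * s) ^ 2 = κ ^ 2 * (a * c + b * d) ^ 2 := by rw [e]; ring
    have h1 : 0 ≤ κ ^ 2 * (a * d - b * c) ^ 2 := by positivity
    have h2 : 0 ≤ -κ * (a ^ 2 + b ^ 2) := by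
      have : 0 < -κ := by linarith
      positivity
    nlinarith [mul_nonneg h2 hv]
  have hs0 : s = 0 := by
    by_contra hne
    have : 0 < (t * t + κ * (a * a + b * b)) * s ^ 2 := by positivity
    linarith
  subst hs0
  have hcd : c ^ 2 + d ^ 2 = 0 := by
    by_contra hne
    have : 0 < c ^ 2 + d ^ 2 := lt_of_le_of_ne (by positivity) (Ne.symm hne)
    nlinarith
  have hc : c = 0 := by nlinarith [sq_nonneg c, sq_nonneg d]
  have hd : d = 0 := by nlinarith [sq_nonneg c, sq_nonneg d]
  simp [hc, hd]

/-- The reversed Cauchy–Schwarz inequality of the Lorentzian form. -/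
theorem ambientForm_mul_le_sq {κ : ℝ} (hκ : κ < 0) {u : ℝ × ℝ × ℝ} (v : ℝ × ℝ × ℝ)
    (hu : 0 < ambientForm κ u u) :
    ambientForm κ u u * ambientForm κ v v ≤ ambientForm κ u v ^ 2 := by
  by_contra! h
  set n : ℝ × ℝ × ℝ := ambientForm κ u u • v - ambientForm κ u v • u with hn
  have hun : ambientForm κ u n = 0 := by
    rw [hn, ambientForm_sub_right, ambientForm_smul_right, ambientForm_smul_right]; ring
  have hnn : ambientForm κ n n =
      ambientForm κ u u * (ambientForm κ u u * ambientForm κ v v - ambientForm κ u v ^ 2) := by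
    simp only [hn, ambientForm_sub_left, ambientForm_sub_right, ambientForm_smul_left,
      ambientForm_smul_right, ambientForm_comm κ v u]
    ring
  have hpos : 0 < ambientForm κ n n := by
    rw [hnn]; exact mul_pos hu (by linarith)
  have h0 := eq_zero_of_ambientForm_eq_zero hκ hu hun hpos.le
  rw [h0] at hpos
  simp [ambientForm] at hpos

/-! ### Points and distances of the model surface -/

theorem modelForm_comm {κ : ℝ} (p q : ModelSurface κ) : modelForm p q = modelForm q p :=
  ambientForm_comm κ p.vec q.vec

theorem modelDist_comm {κ : ℝ} (p q : ModelSurface κ) : modelDist p q = modelDist q p := by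
  simp only [modelDist, modelForm_comm p q, sub_sq_comm p.a q.a, sub_sq_comm p.b q.b]

/-- The expansion of the form on `α x + β z - γ y - δ w` in the forms of the six pairs. -/
theorem ambientForm_sub_combination {κ : ℝ} (x y z w : ModelSurface κ) (α β γ δ : ℝ) :
    ambientForm κ (α • x.vec + β • z.vec - (γ • y.vec + δ • w.vec))
      (α • x.vec + β • z.vec - (γ • y.vec + δ • w.vec)) =
    α ^ 2 + β ^ 2 + γ ^ 2 + δ ^ 2 + 2 * (α * β) * modelForm x z + 2 * (γ * δ) * modelForm y w
      - 2 * (α * γ) * modelForm x y - 2 * (α * δ) * modelForm w x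
      - 2 * (β * γ) * modelForm y z - 2 * (β * δ) * modelForm z w := by
  simp only [ambientForm_sub_left, ambientForm_sub_right, ambientForm_add_left,
    ambientForm_add_right, ambientForm_smul_left, ambientForm_smul_right, ambientForm_vec_self,
    modelForm_eq_ambientForm, ambientForm_comm κ z.vec x.vec, ambientForm_comm κ w.vec y.vec,
    ambientForm_comm κ y.vec x.vec, ambientForm_comm κ x.vec w.vec,
    ambientForm_comm κ z.vec y.vec, ambientForm_comm κ w.vec z.vec]
  ring

theorem ambientForm_combination {κ : ℝ} (x y z w : ModelSurface κ) (α β γ δ : ℝ) :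
    ambientForm κ (α • x.vec + β • z.vec) (γ • y.vec + δ • w.vec) =
      α * γ * modelForm x y + α * δ * modelForm w x
      + β * γ * modelForm y z + β * δ * modelForm z w := by
  simp only [ambientForm_add_left,
    ambientForm_add_right, ambientForm_smul_left, ambientForm_smul_right,
    modelForm_eq_ambientForm, ambientForm_comm κ x.vec w.vec, ambientForm_comm κ z.vec y.vec]
  ring

theorem ambientForm_combination_self {κ : ℝ} (x z : ModelSurface κ) (α β : ℝ) :
    ambientForm κ (α • x.vec + β • z.vec) (α • x.vec + β • z.vec) =
      α ^ 2 + β ^ 2 + 2 * (α * β) * modelForm x z := by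
  simp only [ambientForm_add_left,
    ambientForm_add_right, ambientForm_smul_left, ambientForm_smul_right,
    modelForm_eq_ambientForm, ambientForm_vec_self, ambientForm_comm κ z.vec x.vec]
  ring

theorem ambientForm_combination_left {κ : ℝ} (x z y : ModelSurface κ) (α β : ℝ) :
    ambientForm κ (α • x.vec + β • z.vec) y.vec = α * modelForm x y + β * modelForm y z := by
  rw [ambientForm_add_left, ambientForm_smul_left, ambientForm_smul_left, modelForm_comm y z]
  rfl

theorem modelForm_mem_Icc {κ : ℝ} (hκ : 0 < κ) (p q : ModelSurface κ) :
    modelForm p q ∈ Set.Icc (-1) 1 := by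
  have h1 := ambientForm_self_nonneg hκ ((1 : ℝ) • p.vec + (1 : ℝ) • q.vec)
  have h2 := ambientForm_self_nonneg hκ ((1 : ℝ) • p.vec + (-1 : ℝ) • q.vec)
  rw [ambientForm_combination_self] at h1 h2
  constructor <;> linarith

theorem one_le_modelForm {κ : ℝ} (hκ : κ < 0) (p q : ModelSurface κ) : 1 ≤ modelForm p q := by
  have hsq := ambientForm_mul_le_sq hκ q.vec
    (by rw [ambientForm_vec_self p]; exact one_pos)
  rw [ambientForm_vec_self, ambientForm_vec_self, ← modelForm_eq_ambientForm] at hsq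
  -- Both points lie on the upper sheet, which decides the sign of the form.
  have hpos : 0 < modelForm p q := by
    have hp := p.sheet hκ.le
    have hq := q.sheet hκ.le
    have h1 := p.eqn
    have h2 := q.eqn
    have key : (-κ * (p.a * q.a + p.b * q.b)) ^ 2 < (p.t * q.t) ^ 2 := by
      have e : (p.t * q.t) ^ 2 =
          (1 - κ * (p.a ^ 2 + p.b ^ 2)) * (1 - κ * (q.a ^ 2 + q.b ^ 2)) := by
        rw [mul_pow]; congr 1 <;> linarith
      rw [e]
      have h3 : 0 ≤ κ ^ 2 * (p.a * q.b - p.b * q.a) ^ 2 := by positivity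
      have h4 : 0 ≤ -κ * (p.a ^ 2 + p.b ^ 2) := mul_nonneg (by linarith) (by positivity)
      have h5 : 0 ≤ -κ * (q.a ^ 2 + q.b ^ 2) := mul_nonneg (by linarith) (by positivity)
      nlinarith
    have := abs_lt_of_sq_lt_sq key (by positivity)
    have := (abs_lt.mp this).2
    simp only [modelForm]
    linarith
  nlinarith

theorem modelDist_of_pos {κ : ℝ} (hκ : 0 < κ) (p q : ModelSurface κ) :
    modelDist p q = Real.arccos (modelForm p q) / √κ := by
  simp [modelDist, hκ]

theorem modelDist_of_neg {κ : ℝ} (hκ : κ < 0) (p q : ModelSurface κ) :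
    modelDist p q = Real.arcosh (modelForm p q) / √(-κ) := by
  simp [modelDist, hκ.not_gt, hκ.ne]

theorem modelDist_zero (p q : ModelSurface 0) :
    modelDist p q = √((p.a - q.a) ^ 2 + (p.b - q.b) ^ 2) := by
  simp [modelDist]

theorem modelDist_le_iff_of_pos {κ : ℝ} (hκ : 0 < κ) (p q p' q' : ModelSurface κ) :
    modelDist p q ≤ modelDist p' q' ↔ modelForm p' q' ≤ modelForm p q := by
  rw [modelDist_of_pos hκ, modelDist_of_pos hκ, div_le_div_iff_of_pos_right (Real.sqrt_pos.2 hκ),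
    Real.strictAntiOn_arccos.le_iff_ge (modelForm_mem_Icc hκ p q) (modelForm_mem_Icc hκ p' q')]

theorem modelDist_le_iff_of_neg {κ : ℝ} (hκ : κ < 0) (p q p' q' : ModelSurface κ) :
    modelDist p q ≤ modelDist p' q' ↔ modelForm p q ≤ modelForm p' q' := by
  rw [modelDist_of_neg hκ, modelDist_of_neg hκ,
    div_le_div_iff_of_pos_right (Real.sqrt_pos.2 (neg_pos.2 hκ)),
    Real.arcosh_le_arcosh (one_pos.trans_le (one_le_modelForm hκ p q))
      (one_pos.trans_le (one_le_modelForm hκ p' q'))]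

theorem modelDist_le_iff_zero (p q p' q' : ModelSurface 0) :
    modelDist p q ≤ modelDist p' q' ↔
      (p.a - q.a) ^ 2 + (p.b - q.b) ^ 2 ≤ (p'.a - q'.a) ^ 2 + (p'.b - q'.b) ^ 2 := by
  rw [modelDist_zero, modelDist_zero, Real.sqrt_le_sqrt_iff (by positivity)]

theorem t_eq_one (p : ModelSurface 0) : p.t = 1 := by
  have h1 := p.eqn
  have h2 := p.sheet le_rfl
  nlinarith

/-! ### Points of segments as nonnegative combinations of the endpoints -/

theorem modelDist_add_of_mem_segment {κ : ℝ} {x z p : ModelSurface κ} (hp : p ∈ modelSegment x z) :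
    modelDist x p + modelDist p z = modelDist x z := by
  obtain ⟨S, ⟨γ, h0, h1, hγ, rfl⟩, s, hs, rfl⟩ := hp
  have hd : 0 ≤ modelDist x z := hs.1.trans hs.2
  have e1 := hγ 0 ⟨le_rfl, hd⟩ s hs
  have e2 := hγ s hs _ ⟨hd, le_rfl⟩
  rw [h0, zero_sub, abs_neg, abs_of_nonneg hs.1] at e1
  rw [h1, abs_of_nonpos (by linarith [hs.2])] at e2
  linarith

theorem exists_nonneg_combination_of_pos {κ : ℝ} (hκ : 0 < κ) {x z p : ModelSurface κ}
    (hadd : modelDist x p + modelDist p z = modelDist x z)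
    (hlt : (modelDist x z : EReal) < modelDiam κ) :
    ∃ α β : ℝ, 0 ≤ α ∧ 0 ≤ β ∧ p.vec = α • x.vec + β • z.vec := by
  have hsq := Real.sqrt_pos.2 hκ
  rw [modelDiam, if_pos hκ, EReal.coe_lt_coe_iff, modelDist_of_pos hκ,
    div_lt_div_iff_of_pos_right hsq] at hlt
  rw [modelDist_of_pos hκ, modelDist_of_pos hκ, modelDist_of_pos hκ, ← add_div,
    div_left_inj' hsq.ne'] at hadd
  have c1 := Real.cos_arccos (modelForm_mem_Icc hκ x p).1 (modelForm_mem_Icc hκ x p).2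
  have c2 := Real.cos_arccos (modelForm_mem_Icc hκ p z).1 (modelForm_mem_Icc hκ p z).2
  have c3 := Real.cos_arccos (modelForm_mem_Icc hκ x z).1 (modelForm_mem_Icc hκ x z).2
  rw [← hadd] at c3 hlt
  have n1 := Real.arccos_nonneg (modelForm x p)
  have n2 := Real.arccos_nonneg (modelForm p z)
  set A := Real.arccos (modelForm x p)
  set C := Real.arccos (modelForm p z)
  rcases (add_nonneg n1 n2).eq_or_lt with h0 | hpos
  · -- Here `A = 0`, so `p = x`.
    have hA : A = 0 := by linarith
    refine ⟨1, 0, zero_le_one, le_rfl, ?_⟩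
    rw [hA, Real.cos_zero] at c1
    have : (1 : ℝ) • x.vec + (-1 : ℝ) • p.vec = 0 := by
      apply eq_zero_of_ambientForm_self_nonpos hκ
      rw [ambientForm_combination_self, ← c1]
      norm_num
    simp only [one_smul, zero_smul, neg_smul, add_zero] at this ⊢
    exact (add_neg_eq_zero.mp this).symm
  · have hsin : 0 < Real.sin (A + C) := Real.sin_pos_of_pos_of_lt_pi hpos hlt
    have hsA : 0 ≤ Real.sin A := Real.sin_nonneg_of_nonneg_of_le_pi n1 (by linarith)
    have hsC : 0 ≤ Real.sin C := Real.sin_nonneg_of_nonneg_of_le_pi n2 (by linarith)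
    refine ⟨Real.sin C / Real.sin (A + C), Real.sin A / Real.sin (A + C), by positivity,
      by positivity, ?_⟩
    have hz : (Real.sin C / Real.sin (A + C)) • x.vec + (Real.sin A / Real.sin (A + C)) • z.vec
        - ((1 : ℝ) • p.vec + (0 : ℝ) • p.vec) = 0 := by
      apply eq_zero_of_ambientForm_self_nonpos hκ
      rw [ambientForm_sub_combination, ← c1, modelForm_comm z p, ← c2, ← c3]
      apply le_of_eq
      field_simp
      rw [Real.sin_add, Real.cos_add]
      have s1 := Real.sin_sq_add_cos_sq A
      have s2 := Real.sin_sq_add_cos_sq C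
      have e1 : Real.cos A ^ 2 = 1 - Real.sin A ^ 2 := by linarith
      have e2 : Real.cos C ^ 2 = 1 - Real.sin C ^ 2 := by linarith
      ring_nf
      simp only [e1, e2]
      ring
    rw [sub_eq_zero] at hz
    simpa using hz.symm

theorem exists_nonneg_combination_of_neg {κ : ℝ} (hκ : κ < 0) {x z p : ModelSurface κ}
    (hadd : modelDist x p + modelDist p z = modelDist x z) :
    ∃ α β : ℝ, 0 ≤ α ∧ 0 ≤ β ∧ p.vec = α • x.vec + β • z.vec := by
  have hsq := Real.sqrt_pos.2 (neg_pos.2 hκ)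
  rw [modelDist_of_neg hκ, modelDist_of_neg hκ, modelDist_of_neg hκ, ← add_div,
    div_left_inj' hsq.ne'] at hadd
  have c1 := Real.cosh_arcosh (one_le_modelForm hκ x p)
  have c2 := Real.cosh_arcosh (one_le_modelForm hκ p z)
  have c3 := Real.cosh_arcosh (one_le_modelForm hκ x z)
  rw [← hadd] at c3
  have n1 := Real.arcosh_nonneg (one_le_modelForm hκ x p)
  have n2 := Real.arcosh_nonneg (one_le_modelForm hκ p z)
  set A := Real.arcosh (modelForm x p)
  set C := Real.arcosh (modelForm p z)
  have hx : 0 < ambientForm κ x.vec x.vec := by rw [ambientForm_vec_self]; exact one_pos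
  rcases (add_nonneg n1 n2).eq_or_lt with h0 | hpos
  · -- Here `A = 0`, so `p = x`.
    have hA : A = 0 := by linarith
    refine ⟨1, 0, zero_le_one, le_rfl, ?_⟩
    rw [hA, Real.cosh_zero] at c1
    have : (1 : ℝ) • x.vec + (-1 : ℝ) • p.vec = 0 := by
      apply eq_zero_of_ambientForm_eq_zero hκ hx
      · rw [ambientForm_comm, ambientForm_combination_left, ← c1,
          modelForm_eq_ambientForm, ambientForm_vec_self]
        norm_num
      · rw [ambientForm_combination_self, ← c1]
        norm_num
    simp only [one_smul, zero_smul, neg_smul, add_zero] at this ⊢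
    exact (add_neg_eq_zero.mp this).symm
  · have hsin : 0 < Real.sinh (A + C) := Real.sinh_pos_iff.2 hpos
    have hsA : 0 ≤ Real.sinh A := Real.sinh_nonneg_iff.2 n1
    have hsC : 0 ≤ Real.sinh C := Real.sinh_nonneg_iff.2 n2
    refine ⟨Real.sinh C / Real.sinh (A + C), Real.sinh A / Real.sinh (A + C), by positivity,
      by positivity, ?_⟩
    have e1 := Real.cosh_sq A
    have e2 := Real.cosh_sq C
    -- The difference is orthogonal to `x` and null, hence zero.
    have hz : (Real.sinh C / Real.sinh (A + C)) • x.vec + (Real.sinh A / Real.sinh (A + C)) • z.vec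
        - ((1 : ℝ) • p.vec + (0 : ℝ) • p.vec) = 0 := by
      apply eq_zero_of_ambientForm_eq_zero hκ hx
      · rw [ambientForm_comm, ambientForm_sub_left, ambientForm_combination_left,
          ambientForm_combination_left, ← c3, modelForm_comm p x, ← c1, modelForm_eq_ambientForm,
          ambientForm_vec_self]
        field_simp
        rw [Real.sinh_add, Real.cosh_add]
        ring_nf
        simp only [e1]
        ring
      · rw [ambientForm_sub_combination, ← c1, modelForm_comm z p, ← c2, ← c3]
        apply ge_of_eq
        field_simp
        rw [Real.sinh_add, Real.cosh_add]
        ring_nf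
        simp only [e1, e2]
        ring
    rw [sub_eq_zero] at hz
    simpa using hz.symm

theorem exists_nonneg_combination_zero {x z p : ModelSurface 0}
    (hadd : modelDist x p + modelDist p z = modelDist x z) :
    ∃ α β : ℝ, 0 ≤ α ∧ 0 ≤ β ∧ p.vec = α • x.vec + β • z.vec := by
  rw [modelDist_zero, modelDist_zero, modelDist_zero] at hadd
  have s1 := Real.sq_sqrt (show 0 ≤ (x.a - p.a) ^ 2 + (x.b - p.b) ^ 2 by positivity)
  have s2 := Real.sq_sqrt (show 0 ≤ (p.a - z.a) ^ 2 + (p.b - z.b) ^ 2 by positivity)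
  have s3 := Real.sq_sqrt (show 0 ≤ (x.a - z.a) ^ 2 + (x.b - z.b) ^ 2 by positivity)
  rw [← hadd] at s3
  have n1 := Real.sqrt_nonneg ((x.a - p.a) ^ 2 + (x.b - p.b) ^ 2)
  have n2 := Real.sqrt_nonneg ((p.a - z.a) ^ 2 + (p.b - z.b) ^ 2)
  set A := √((x.a - p.a) ^ 2 + (x.b - p.b) ^ 2)
  set C := √((p.a - z.a) ^ 2 + (p.b - z.b) ^ 2)
  rcases (add_nonneg n1 n2).eq_or_lt with h0 | hpos
  · have hA : A = 0 := by linarith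
    rw [hA] at s1
    refine ⟨1, 0, zero_le_one, le_rfl, ?_⟩
    have ha : p.a = x.a := by nlinarith [sq_nonneg (x.a - p.a), sq_nonneg (x.b - p.b)]
    have hb : p.b = x.b := by nlinarith [sq_nonneg (x.a - p.a), sq_nonneg (x.b - p.b)]
    simp [ModelSurface.vec, t_eq_one, ha, hb]
  · refine ⟨C / (A + C), A / (A + C), by positivity, by positivity, ?_⟩
    have key : ((A + C) * p.a - (C * x.a + A * z.a)) ^ 2
        + ((A + C) * p.b - (C * x.b + A * z.b)) ^ 2 = 0 := by
      linear_combination (-(A + C) * C) * s1 - (A + C) * A * s2 + A * C * s3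
    have ha : (A + C) * p.a - (C * x.a + A * z.a) = 0 := by
      rw [← sq_eq_zero_iff]; refine le_antisymm ?_ (sq_nonneg _)
      linarith [sq_nonneg ((A + C) * p.b - (C * x.b + A * z.b))]
    have hb : (A + C) * p.b - (C * x.b + A * z.b) = 0 := by
      rw [← sq_eq_zero_iff]; refine le_antisymm ?_ (sq_nonneg _)
      linarith [sq_nonneg ((A + C) * p.a - (C * x.a + A * z.a))]
    simp only [ModelSurface.vec, t_eq_one, Prod.smul_mk, smul_eq_mul, Prod.mk_add_mk,
      Prod.mk.injEq]
    refine ⟨?_, ?_, ?_⟩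
    · field_simp; ring
    · field_simp; linarith
    · field_simp; linarith

theorem exists_nonneg_combination {κ : ℝ} {x z p : ModelSurface κ} (hp : p ∈ modelSegment x z)
    (hlt : (modelDist x z : EReal) < modelDiam κ) :
    ∃ α β : ℝ, 0 ≤ α ∧ 0 ≤ β ∧ p.vec = α • x.vec + β • z.vec := by
  have hadd := modelDist_add_of_mem_segment hp
  rcases lt_trichotomy κ 0 with hκ | rfl | hκ
  · exact exists_nonneg_combination_of_neg hκ hadd
  · exact exists_nonneg_combination_zero hadd
  · exact exists_nonneg_combination_of_pos hκ hadd hlt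

theorem eq_of_vec_eq_smul {κ : ℝ} {p q : ModelSurface κ} {c : ℝ} (hc : 0 ≤ c)
    (h : p.vec = c • q.vec) : p = q := by
  have h1 := ambientForm_vec_self p
  rw [h, ambientForm_smul_left, ambientForm_smul_right, ambientForm_vec_self] at h1
  have : c = 1 := by nlinarith
  rw [this, one_smul] at h
  exact ModelSurface.vec_injective h

/-! ### Comparison when the diagonals meet at a vertex -/

theorem modelDist_le_of_vertex_of_pos {κ : ℝ} (hκ : 0 < κ) {x y z w x' y' z' w' : ModelSurface κ}
    {α β : ℝ} (hα : 0 ≤ α) (hβ : 0 ≤ β) (hy : y'.vec = α • x'.vec + β • z'.vec)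
    (hxy : modelDist x y ≤ modelDist x' y') (hyz : modelDist y z ≤ modelDist y' z')
    (hzw : modelDist z w ≤ modelDist z' w') (hwx : modelDist w x ≤ modelDist w' x')
    (hxz : modelDist x' z' ≤ modelDist x z) : modelDist y w ≤ modelDist y' w' := by
  rw [modelDist_le_iff_of_pos hκ] at *
  have e' := ambientForm_combination_self x' z' α β
  rw [← hy, ambientForm_vec_self] at e'
  have f' := ambientForm_combination_left x' z' y' α β
  rw [← hy, ambientForm_vec_self] at f'
  have g' := ambientForm_combination_left x' z' w' α β
  rw [← hy, ← modelForm_eq_ambientForm, modelForm_comm x' w', modelForm_comm w' z'] at g'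
  have hP : α • x.vec + β • z.vec - ((1 : ℝ) • y.vec + (0 : ℝ) • y.vec) = 0 := by
    apply eq_zero_of_ambientForm_self_nonpos hκ
    rw [ambientForm_sub_combination]
    have := mul_le_mul_of_nonneg_left hxz (mul_nonneg hα hβ)
    have := mul_le_mul_of_nonneg_left hxy hα
    have := mul_le_mul_of_nonneg_left hyz hβ
    linarith
  have hP' : y.vec = α • x.vec + β • z.vec := by
    rw [sub_eq_zero] at hP
    simpa using hP.symm
  have g := ambientForm_combination_left x z w α β
  rw [← hP', ← modelForm_eq_ambientForm, modelForm_comm x w, modelForm_comm w z] at g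
  rw [g, g']
  gcongr

theorem modelDist_le_of_vertex_of_neg {κ : ℝ} (hκ : κ < 0) {x y z w x' y' z' w' : ModelSurface κ}
    {α β : ℝ} (hα : 0 ≤ α) (hβ : 0 ≤ β) (hy : y'.vec = α • x'.vec + β • z'.vec)
    (hxy : modelDist x y ≤ modelDist x' y') (hyz : modelDist y z ≤ modelDist y' z')
    (hzw : modelDist z w ≤ modelDist z' w') (hwx : modelDist w x ≤ modelDist w' x')
    (hxz : modelDist x' z' ≤ modelDist x z) : modelDist y w ≤ modelDist y' w' := by
  rw [modelDist_le_iff_of_neg hκ] at *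
  have e' := ambientForm_combination_self x' z' α β
  rw [← hy, ambientForm_vec_self] at e'
  have f' := ambientForm_combination_left x' z' y' α β
  rw [← hy, ambientForm_vec_self] at f'
  have g' := ambientForm_combination_left x' z' w' α β
  rw [← hy, ← modelForm_eq_ambientForm, modelForm_comm x' w', modelForm_comm w' z'] at g'
  have e := ambientForm_combination_self x z α β
  have f := ambientForm_combination_left x z y α β
  have hmul := mul_le_mul_of_nonneg_left hxz (mul_nonneg hα hβ)
  have hm1 := mul_le_mul_of_nonneg_left hxy hα
  have hm2 := mul_le_mul_of_nonneg_left hyz hβ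
  have hPP : 1 ≤ ambientForm κ (α • x.vec + β • z.vec) (α • x.vec + β • z.vec) := by linarith
  have hPy : ambientForm κ (α • x.vec + β • z.vec) y.vec ≤ 1 := by linarith
  have hPy0 : 0 ≤ ambientForm κ (α • x.vec + β • z.vec) y.vec := by
    rw [f]
    have := one_le_modelForm hκ x y
    have := one_le_modelForm hκ y z
    positivity
  -- Reversed Cauchy–Schwarz holds with equality, so `P = α x + β z` is a multiple of `y`.
  set P := α • x.vec + β • z.vec with hPdef
  have hcs := ambientForm_mul_le_sq hκ y.vec (lt_of_lt_of_le one_pos hPP)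
  rw [ambientForm_vec_self, mul_one] at hcs
  have hPy1 : ambientForm κ P y.vec = 1 := by nlinarith
  have hP : P - y.vec = 0 := by
    apply eq_zero_of_ambientForm_eq_zero hκ (u := y.vec)
      (by rw [ambientForm_vec_self]; exact one_pos)
    · rw [ambientForm_sub_right, ambientForm_vec_self, ambientForm_comm, hPy1, sub_self]
    · rw [ambientForm_sub_left, ambientForm_sub_right, ambientForm_sub_right,
        ambientForm_vec_self, ambientForm_comm κ y.vec P, hPy1]
      linarith
  have g := ambientForm_combination_left x z w α β
  rw [← hPdef, sub_eq_zero.mp hP, ← modelForm_eq_ambientForm, modelForm_comm x w,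
    modelForm_comm w z] at g
  rw [g, g']
  gcongr

theorem modelDist_le_of_vertex_zero {x y z w x' y' z' w' : ModelSurface 0}
    {α β : ℝ} (hα : 0 ≤ α) (hβ : 0 ≤ β) (hy : y'.vec = α • x'.vec + β • z'.vec)
    (hxy : modelDist x y ≤ modelDist x' y') (hyz : modelDist y z ≤ modelDist y' z')
    (hzw : modelDist z w ≤ modelDist z' w') (hwx : modelDist w x ≤ modelDist w' x')
    (hxz : modelDist x' z' ≤ modelDist x z) : modelDist y w ≤ modelDist y' w' := by
  rw [modelDist_le_iff_zero] at *
  simp only [ModelSurface.vec, t_eq_one, Prod.smul_mk, smul_eq_mul, Prod.mk_add_mk,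
    Prod.mk.injEq, mul_one] at hy
  obtain ⟨h1, ha, hb⟩ := hy
  obtain rfl : α = 1 - β := by linarith
  have m1 := mul_le_mul_of_nonneg_left hxz (mul_nonneg hα hβ)
  have m2 := mul_le_mul_of_nonneg_left hxy hα
  have m3 := mul_le_mul_of_nonneg_left hyz hβ
  have m4 := mul_le_mul_of_nonneg_left hwx hα
  have m5 := mul_le_mul_of_nonneg_left hzw hβ
  have key : ((1 - β) * x.a + β * z.a - y.a) ^ 2 + ((1 - β) * x.b + β * z.b - y.b) ^ 2 ≤ 0 := by
    rw [ha, hb] at m2 m3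
    linarith
  obtain ⟨ha0, hb0⟩ := (add_eq_zero_iff_of_nonneg (sq_nonneg _) (sq_nonneg _)).1
    (le_antisymm key (by positivity))
  have ha2 : y.a = (1 - β) * x.a + β * z.a := by linarith [sq_eq_zero_iff.1 ha0]
  have hb2 : y.b = (1 - β) * x.b + β * z.b := by linarith [sq_eq_zero_iff.1 hb0]
  rw [ha, hb, ha2, hb2]
  linarith

theorem modelDist_le_of_vertex {κ : ℝ} {x y z w x' y' z' w' : ModelSurface κ}
    {α β : ℝ} (hα : 0 ≤ α) (hβ : 0 ≤ β) (hy : y'.vec = α • x'.vec + β • z'.vec)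
    (hxy : modelDist x y ≤ modelDist x' y') (hyz : modelDist y z ≤ modelDist y' z')
    (hzw : modelDist z w ≤ modelDist z' w') (hwx : modelDist w x ≤ modelDist w' x')
    (hxz : modelDist x' z' ≤ modelDist x z) : modelDist y w ≤ modelDist y' w' := by
  rcases lt_trichotomy κ 0 with hκ | rfl | hκ
  · exact modelDist_le_of_vertex_of_neg hκ hα hβ hy hxy hyz hzw hwx hxz
  · exact modelDist_le_of_vertex_zero hα hβ hy hxy hyz hzw hwx hxz
  · exact modelDist_le_of_vertex_of_pos hκ hα hβ hy hxy hyz hzw hwx hxz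

/-! ### Comparison when the diagonals meet inside `[y', w']` -/

theorem modelDist_le_of_crossing {κ : ℝ} {x y z w x' y' z' w' p : ModelSurface κ}
    {α β γ δ : ℝ} (hα : 0 ≤ α) (hβ : 0 ≤ β) (hγ : 0 < γ) (hδ : 0 < δ)
    (hp : p.vec = α • x'.vec + β • z'.vec) (hq : p.vec = γ • y'.vec + δ • w'.vec)
    (hxy : modelDist x y ≤ modelDist x' y') (hyz : modelDist y z ≤ modelDist y' z')
    (hzw : modelDist z w ≤ modelDist z' w') (hwx : modelDist w x ≤ modelDist w' x')
    (hxz : modelDist x' z' ≤ modelDist x z) : modelDist y w ≤ modelDist y' w' := by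
  have hαβ := mul_nonneg hα hβ
  have hαγ := mul_nonneg hα hγ.le
  have hαδ := mul_nonneg hα hδ.le
  have hβγ := mul_nonneg hβ hγ.le
  have hβδ := mul_nonneg hβ hδ.le
  have hγδ := mul_pos hγ hδ
  have e1 := ambientForm_combination_self x' z' α β
  rw [← hp, ambientForm_vec_self] at e1
  have e2 := ambientForm_combination_self y' w' γ δ
  rw [← hq, ambientForm_vec_self] at e2
  have e3 := ambientForm_combination x' y' z' w' α β γ δ
  rw [← hp, ← hq, ambientForm_vec_self] at e3
  rcases lt_trichotomy κ 0 with hκ | rfl | hκ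
  · rw [modelDist_le_iff_of_neg hκ] at *
    have m1 := mul_le_mul_of_nonneg_left hxz hαβ
    have m2 := mul_le_mul_of_nonneg_left hxy hαγ
    have m3 := mul_le_mul_of_nonneg_left hwx hαδ
    have m4 := mul_le_mul_of_nonneg_left hyz hβγ
    have m5 := mul_le_mul_of_nonneg_left hzw hβδ
    by_contra! hcon
    have m6 := mul_lt_mul_of_pos_left hcon hγδ
    have f1 := ambientForm_combination_self x z α β
    have f2 := ambientForm_combination_self y w γ δ
    have f3 := ambientForm_combination x y z w α β γ δ
    have hPP : 1 ≤ ambientForm κ (α • x.vec + β • z.vec) (α • x.vec + β • z.vec) := by linarith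
    have hQQ : 1 < ambientForm κ (γ • y.vec + δ • w.vec) (γ • y.vec + δ • w.vec) := by linarith
    have hPQ : ambientForm κ (α • x.vec + β • z.vec) (γ • y.vec + δ • w.vec) ≤ 1 := by linarith
    have hPQ0 : 0 ≤ ambientForm κ (α • x.vec + β • z.vec) (γ • y.vec + δ • w.vec) := by
      have := one_le_modelForm hκ x y
      have := one_le_modelForm hκ w x
      have := one_le_modelForm hκ y z
      have := one_le_modelForm hκ z w
      rw [f3]
      positivity
    have hcs := ambientForm_mul_le_sq hκ (γ • y.vec + δ • w.vec) (lt_of_lt_of_le one_pos hPP)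
    nlinarith
  · rw [modelDist_le_iff_zero] at *
    have m1 := mul_le_mul_of_nonneg_left hxz hαβ
    have m2 := mul_le_mul_of_nonneg_left hxy hαγ
    have m3 := mul_le_mul_of_nonneg_left hwx hαδ
    have m4 := mul_le_mul_of_nonneg_left hyz hβγ
    have m5 := mul_le_mul_of_nonneg_left hzw hβδ
    rw [hp] at hq
    have hsum := congrArg Prod.fst hp
    simp only [ModelSurface.vec, t_eq_one, Prod.smul_mk, smul_eq_mul, Prod.mk_add_mk,
      Prod.mk.injEq, mul_one] at hq hsum
    obtain ⟨h1, ha, hb⟩ := hq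
    obtain rfl : α = 1 - β := by linarith
    obtain rfl : γ = 1 - δ := by linarith
    -- The expansion of `|P - Q|²` in squared distances, for both configurations.
    have key' : 0 = ((1 - β) * x'.a + β * z'.a - ((1 - δ) * y'.a + δ * w'.a)) ^ 2
        + ((1 - β) * x'.b + β * z'.b - ((1 - δ) * y'.b + δ * w'.b)) ^ 2 := by
      rw [ha, hb]; ring
    have key : 0 ≤ ((1 - β) * x.a + β * z.a - ((1 - δ) * y.a + δ * w.a)) ^ 2
        + ((1 - β) * x.b + β * z.b - ((1 - δ) * y.b + δ * w.b)) ^ 2 := by positivity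
    refine le_of_mul_le_mul_left ?_ hγδ
    linarith
  · rw [modelDist_le_iff_of_pos hκ] at *
    have m1 := mul_le_mul_of_nonneg_left hxz hαβ
    have m2 := mul_le_mul_of_nonneg_left hxy hαγ
    have m3 := mul_le_mul_of_nonneg_left hwx hαδ
    have m4 := mul_le_mul_of_nonneg_left hyz hβγ
    have m5 := mul_le_mul_of_nonneg_left hzw hβδ
    have key := ambientForm_self_nonneg hκ (α • x.vec + β • z.vec - (γ • y.vec + δ • w.vec))
    rw [ambientForm_sub_combination] at key
    refine le_of_mul_le_mul_left ?_ hγδ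
    linarith

/-! ### Quadruples of the model surface and of `Cycl₄(κ)` spaces -/

theorem modelDist_le_of_not_lt_diam {κ : ℝ} {p q : ModelSurface κ} (r s : ModelSurface κ)
    (h : ¬ (modelDist p q : EReal) < modelDiam κ) : modelDist r s ≤ modelDist p q := by
  by_cases hκ : 0 < κ
  · rw [modelDiam, if_pos hκ, EReal.coe_lt_coe_iff, not_lt] at h
    refine le_trans ?_ h
    rw [modelDist_of_pos hκ]
    gcongr
    exact Real.arccos_le_pi _
  · exact absurd (by simp [modelDiam, hκ]) h

/-- In the model surface, shortening the sides of a quadrilateral whose diagonals meet, while not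
shortening one diagonal, does not lengthen the other diagonal. -/
theorem modelDist_diagonal_le {κ : ℝ} {x y z w x' y' z' w' : ModelSurface κ}
    (hlt : (modelDist x' z' : EReal) < modelDiam κ)
    (hne : (modelSegment x' z' ∩ modelSegment y' w').Nonempty)
    (hxy : modelDist x y ≤ modelDist x' y') (hyz : modelDist y z ≤ modelDist y' z')
    (hzw : modelDist z w ≤ modelDist z' w') (hwx : modelDist w x ≤ modelDist w' x')
    (hxz : modelDist x' z' ≤ modelDist x z) : modelDist y w ≤ modelDist y' w' := by
  by_cases hyw : (modelDist y' w' : EReal) < modelDiam κ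
  swap
  · exact modelDist_le_of_not_lt_diam y w hyw
  obtain ⟨p, hp, hq⟩ := hne
  obtain ⟨α, β, hα, hβ, hp⟩ := exists_nonneg_combination hp hlt
  obtain ⟨γ, δ, hγ, hδ, hq⟩ := exists_nonneg_combination hq hyw
  rcases hγ.eq_or_lt with rfl | hγ'
  · -- Here `p = w'`, and reversing the quadrilateral exchanges `y` and `w`.
    obtain rfl := eq_of_vec_eq_smul hδ (by simpa using hq)
    rw [modelDist_comm y w, modelDist_comm y' p]
    rw [modelDist_comm x y, modelDist_comm x' y'] at hxy
    rw [modelDist_comm y z, modelDist_comm y' z'] at hyz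
    rw [modelDist_comm z w, modelDist_comm z' p] at hzw
    rw [modelDist_comm w x, modelDist_comm p x'] at hwx
    exact modelDist_le_of_vertex hα hβ hp hwx hzw hyz hxy hxz
  rcases hδ.eq_or_lt with rfl | hδ'
  · obtain rfl := eq_of_vec_eq_smul hγ (by simpa using hq)
    exact modelDist_le_of_vertex hα hβ hp hxy hyz hzw hwx hxz
  exact modelDist_le_of_crossing hα hβ hγ' hδ' hp hq hxy hyz hzw hwx hxz

theorem mainTheorem4 (κ : ℝ) (X : Type*) [MetricSpace X] (hX : IsCycl 4 κ X) :
    QuadrupleCondition κ X := by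
  intro x y z w x' y' z' w' hper hne hxy hyz hzw hwx hxz
  -- The diagonal `[x', z']` is at most half of the perimeter.
  have hlt : (modelDist x' z' : EReal) < modelDiam κ := by
    by_cases hκ : 0 < κ
    · have htwo : (2 : EReal) = ((2 : ℝ) : EReal) := rfl
      rw [modelDiam, if_pos hκ, htwo, ← EReal.coe_mul, EReal.coe_lt_coe_iff] at hper
      rw [modelDiam, if_pos hκ, EReal.coe_lt_coe_iff, ← hxz]
      have h1 := dist_triangle x y z
      have h2 := dist_triangle x w z
      rw [dist_comm x w, dist_comm w z] at h2
      linarith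
    · simp [modelDiam, hκ]
  obtain ⟨g, hg, hg'⟩ := hX (![x, y, z, w] : Fin 4 → X) (by
    have hsum : (∑ i : Fin 4, dist ((![x, y, z, w] : Fin 4 → X) i)
        ((![x, y, z, w] : Fin 4 → X) (i + 1)) : ℝ) =
        dist x y + dist y z + dist z w + dist w x := Fin.sum_univ_four _
    rw [← hsum] at hper
    exact hper)
  have k1 : modelDist (g 0) (g 1) ≤ dist x y := hg 0
  have k2 : modelDist (g 1) (g 2) ≤ dist y z := hg 1
  have k3 : modelDist (g 2) (g 3) ≤ dist z w := hg 2
  have k4 : modelDist (g 3) (g 0) ≤ dist w x := hg 3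
  have k5 : dist x z ≤ modelDist (g 0) (g 2) := hg' 0 2 (by decide) (by decide)
  have k6 : dist y w ≤ modelDist (g 1) (g 3) := hg' 1 3 (by decide) (by decide)
  exact k6.trans (modelDist_diagonal_le hlt hne (hxy ▸ k1) (hyz ▸ k2) (hzw ▸ k3) (hwx ▸ k4)
    (hxz ▸ k5))
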